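/- **Notation and definitions.** For elements of a group write ${}^t g := tgt^{-1}$. A group $\Gamma$ * is *binate* if for every finitely generated subgroup $H\le\Gamma$ there exist a homomorphism $f\colon H\to\Gamma$ with $[H,f(H)]=1$ and an element $t\in\Gamma$ such that ${}^t f(h)=h\cdot f(h)$ for all $h\in H$; * has *commuting $\mathbb Z$-conjugates* if for every finitely generated subgroup $H\le\Gamma$ there exists $t\in\Gamma$ such that $[H,{}^{t^p}H]=1$ for all $p\ge 1$; * has *conjugates in commuting $\mathbb Z$-conjugate* if there exist a subgroup $\Lambda\le\Gamma$ and $t\in\Gamma$ such that $[\Lambda,{}^{t^p}\Lambda]=1$ for all $p\ge1$ and every finite subset of $\Gamma$ is contained in a conjugate of $\Lambda$; * is *dissipated* if it is isomorphic to a group $\Delta$ of bijections of a set $X$ that is the directed union of a family of subsets $(X_i)_{i\in I}$, such that every $g\in\Delta$ has support $\operatorname{supp}(g)=\{x: g(x)\ne x\}$ contained in some $X_i$, and for every $i\in I$ there is $t_i\in\Delta$ such that (1) $t_i^p(X_i)\cap X_i=\varnothing$ for all $p\ge1$, and (2) for every $g\in\Delta$ supported on $X_i$, the map equal to ${}^{t_i^p}g$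 on $t_i^p(X_i)$ for every $p\ge1$ and to the identity elsewhere belongs to $\Delta$. **Construction.** Let $I_1=(0,1)$ and let $\Gamma_1\le\operatorname{Homeo}(\mathbb R)$ be the copy of Thompson's group $F$ acting on $(0,1)$ and fixing its complement pointwise, i.e. the group of homeomorphisms of $\mathbb R$ that are the identity outside $(0,1)$ and piecewise affine with finitely many breakpoints, all dyadic rationals, and with slopes powers of $2$. Inductively, given $I_i$ and $\Gamma_i$, choose $t_{i+1}\in\operatorname{Homeo}(\mathbb R)$ whose support $\{x: t_{i+1}(x)\neq x\}$ is connected and such that $t_{i+1}(I_i)\cap I_i=\varnothing$, and set $\Gamma_{i+1}=\langle\Gamma_i,t_{i+1}\rangle$ and $I_{i+1}=\operatorname{supp}(t_{i+1})$. Let $\Gamma=\bigcup_i\Gamma_i\le\operatorname{Homeo}(\mathbb R)$. **Proposition.** Such sequences $(t_i)_{i\ge2}$ exist, and for every such sequence the group $\Gamma$ has commuting $\mathbb Z$-conjugates, is not binate, is not dissipated, and does not have conjugates in commuting $\mathbb Z$-conjugate. -/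

import Mathlib

universe u v

/-! ### Displacement properties of abstract groups -/

/-- Every finitely generated `H ≤ Γ` admits a homomorphism `f : H → Γ` with `[H, f(H)] = 1` and an
element `t ∈ Γ` with `t f(h) t⁻¹ = h f(h)` for all `h ∈ H`. -/
def IsBinate (Γ : Type*) [Group Γ] : Prop :=
  ∀ H : Subgroup Γ, H.FG → ∃ f : H →* Γ,
    (∀ h k : H, Commute (h : Γ) (f k)) ∧ ∃ t : Γ, ∀ h : H, t * f h * t⁻¹ = (h : Γ) * f h

/-- For every finitely generated `H ≤ Γ` there is `t ∈ Γ` such that `H` commutes elementwise with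
`t ^ p H t ^ (-p)` for all `p ≥ 1`. -/
def HasCommutingZConjugates (Γ : Type*) [Group Γ] : Prop :=
  ∀ H : Subgroup Γ, H.FG → ∃ t : Γ, ∀ p : ℕ, 1 ≤ p →
    ∀ h ∈ H, ∀ k ∈ H, Commute h (t ^ p * k * (t ^ p)⁻¹)

/-- There are `Λ ≤ Γ` and `t ∈ Γ` such that `Λ` commutes elementwise with `t ^ p Λ t ^ (-p)` for all
`p ≥ 1`, and every finite subset of `Γ` is contained in a conjugate `s Λ s⁻¹`. -/
def HasConjugatesInCommutingZConjugate (Γ : Type*) [Group Γ] : Prop :=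
  ∃ (Λ : Subgroup Γ) (t : Γ),
    (∀ p : ℕ, 1 ≤ p → ∀ a ∈ Λ, ∀ b ∈ Λ, Commute a (t ^ p * b * (t ^ p)⁻¹)) ∧
    ∀ S : Finset Γ, ∃ s : Γ, ∀ g ∈ S, s⁻¹ * g * s ∈ Λ

/-! ### Dissipated groups -/

/-- The set of points moved by a self-map. -/
def movedSet {X : Type*} (f : X → X) : Set X := {x | f x ≠ x}

/-- `X` is the directed union of the sets in `𝓑` (the bounded sets), and every element of the
group `Γ` of bijections of `X` has support contained in a bounded set. -/
def IsBoundedlySupported {X : Type*} (Γ : Subgroup (Equiv.Perm X)) (𝓑 : Set (Set X)) : Prop :=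
  DirectedOn (· ⊆ ·) 𝓑 ∧ ⋃₀ 𝓑 = Set.univ ∧ ∀ g ∈ Γ, ∃ B ∈ 𝓑, movedSet g ⊆ B

/-- `t ∈ Γ` is a dissipator for `Γ` and `B`: `t ^ p (B) ∩ B = ∅` for all `p ≥ 1`, and for every
`g ∈ Γ` supported on `B`, the map equal to `t ^ p g t ^ (-p)` on `t ^ p (B)` for every `p ≥ 1` and to
the identity elsewhere belongs to `Γ`. -/
def IsDissipator {X : Type*} (Γ : Subgroup (Equiv.Perm X)) (B : Set X) (t : Equiv.Perm X) : Prop :=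
  t ∈ Γ ∧ (∀ p : ℕ, 1 ≤ p → ((t ^ p) '' B) ∩ B = ∅) ∧
    ∀ g ∈ Γ, movedSet g ⊆ B → ∃ f ∈ Γ,
      (∀ p : ℕ, 1 ≤ p → ∀ x ∈ (t ^ p) '' B, f x = (t ^ p * g * (t ^ p)⁻¹) x) ∧
      ∀ x, (∀ p : ℕ, 1 ≤ p → x ∉ (t ^ p) '' B) → f x = x

/-- A group of bijections of `X` is dissipated with respect to the bounded sets `𝓑`. -/
def IsDissipatedPermGroup {X : Type*} (Γ : Subgroup (Equiv.Perm X)) (𝓑 : Set (Set X)) : Prop :=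
  IsBoundedlySupported Γ 𝓑 ∧ ∀ B ∈ 𝓑, ∃ t, IsDissipator Γ B t

/-- A group is dissipated if it is isomorphic to a group of bijections of some set `X` that is
dissipated with respect to some family of bounded subsets of `X`. -/
def IsDissipated (Γ : Type v) [Group Γ] : Prop :=
  ∃ (X : Type u) (φ : Γ →* Equiv.Perm X) (𝓑 : Set (Set X)),
    Function.Injective φ ∧ IsDissipatedPermGroup φ.range 𝓑

/-! ### Thompson's group `F` acting on `(0, 1)` -/

/-- `x ∈ ℤ[1/2]`. -/
def IsDyadic (x : ℝ) : Prop := ∃ (m : ℤ) (n : ℕ), x = m / 2 ^ n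

/-- `f` is the identity outside `(0, 1)`, and it is piecewise affine with finitely many breakpoints,
all of them dyadic rationals, and with slopes that are powers of `2`. -/
def IsThompsonF (f : ℝ ≃ₜ ℝ) : Prop :=
  (∀ x, x ∉ Set.Ioo (0 : ℝ) 1 → f x = x) ∧
  ∃ S : Finset ℝ, (∀ s ∈ S, IsDyadic s) ∧
    ∀ a b : ℝ, (∀ s ∈ S, s ∉ Set.Ioo a b) →
      ∃ (k : ℤ) (c : ℝ), ∀ x ∈ Set.Ioo a b, f x = (2 : ℝ) ^ k * x + c

theorem isDyadic_zero : IsDyadic 0 := ⟨0, 0, by simp⟩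

theorem IsDyadic.add {x y : ℝ} (hx : IsDyadic x) (hy : IsDyadic y) : IsDyadic (x + y) := by
  obtain ⟨m, n, rfl⟩ := hx
  obtain ⟨m', n', rfl⟩ := hy
  refine ⟨m * 2 ^ n' + m' * 2 ^ n, n + n', ?_⟩
  push_cast
  field_simp
  ring

theorem IsDyadic.neg {x : ℝ} (hx : IsDyadic x) : IsDyadic (-x) := by
  obtain ⟨m, n, rfl⟩ := hx
  exact ⟨-m, n, by push_cast; ring⟩

theorem IsDyadic.zpow_mul {x : ℝ} (hx : IsDyadic x) (k : ℤ) : IsDyadic ((2 : ℝ) ^ k * x) := by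
  obtain ⟨m, n, rfl⟩ := hx
  obtain ⟨j, rfl | rfl⟩ := k.eq_nat_or_neg
  · refine ⟨m * 2 ^ j, n, ?_⟩
    push_cast
    rw [zpow_natCast]
    ring
  · refine ⟨m, n + j, ?_⟩
    rw [zpow_neg, zpow_natCast, pow_add]
    field_simp

theorem IsThompsonF.strictMono {f : ℝ ≃ₜ ℝ} (hf : IsThompsonF f) : StrictMono f := by
  rcases f.continuous.strictMono_of_inj f.injective with h | h
  · exact h
  · have h1 := h (show (-1 : ℝ) < 0 by norm_num)
    rw [hf.1 (-1) (by simp), hf.1 0 (by simp)] at h1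
    norm_num at h1

theorem IsThompsonF.isDyadic {f : ℝ ≃ₜ ℝ} (hf : IsThompsonF f) {d : ℝ} (hd : IsDyadic d) :
    IsDyadic (f d) := by
  obtain ⟨h01, S, hS, haff⟩ := hf
  induction hn : (S.filter (· < d)).card using Nat.strong_induction_on generalizing d with
  | _ n ih =>
    by_cases hd0 : d ≤ 0
    · rw [h01 d (fun h => absurd h.1 (not_lt.2 hd0))]; exact hd
    push Not at hd0
    have key : ∃ s, s < d ∧ IsDyadic s ∧ IsDyadic (f s) ∧ ∀ r ∈ S, r ∉ Set.Ioo s d := by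
      rcases (S.filter (· < d)).eq_empty_or_nonempty with he | hne
      · refine ⟨0, hd0, isDyadic_zero, ?_, fun r hr hrd => ?_⟩
        · rw [h01 0 (by simp)]; exact isDyadic_zero
        · have : r ∈ S.filter (· < d) := Finset.mem_filter.2 ⟨hr, hrd.2⟩
          simp [he] at this
      · set s := (S.filter (· < d)).max' hne
        have hsm : s ∈ S.filter (· < d) := Finset.max'_mem _ _
        have hsd := (Finset.mem_filter.1 hsm).2
        have hsS := (Finset.mem_filter.1 hsm).1
        refine ⟨s, hsd, hS s hsS, ?_, fun r hr hrd => ?_⟩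
        · refine ih _ ?_ (hS s hsS) rfl
          rw [← hn]
          apply Finset.card_lt_card
          refine Finset.ssubset_iff_of_subset ?_ |>.2 ⟨s, hsm, by simp⟩
          intro r hr
          rw [Finset.mem_filter] at hr ⊢
          exact ⟨hr.1, hr.2.trans hsd⟩
        · exact absurd (Finset.le_max' _ r (Finset.mem_filter.2 ⟨hr, hrd.2⟩)) (not_le.2 hrd.1)
    obtain ⟨s, hsd, hs, hfs, hSd⟩ := key
    obtain ⟨k, c, hkc⟩ := haff s d hSd
    have hcl : Set.EqOn f (fun x => (2 : ℝ) ^ k * x + c) (closure (Set.Ioo s d)) :=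
      Set.EqOn.closure hkc f.continuous (by fun_prop)
    rw [closure_Ioo hsd.ne] at hcl
    have e1 : f s = 2 ^ k * s + c := hcl ⟨le_refl _, hsd.le⟩
    have e2 : f d = 2 ^ k * d + c := hcl ⟨hsd.le, le_refl _⟩
    have : f d = f s + 2 ^ k * (d + -s) := by rw [e1, e2]; ring
    rw [this]
    exact hfs.add ((hd.add hs.neg).zpow_mul k)

theorem IsThompsonF.inv {f : ℝ ≃ₜ ℝ} (hf : IsThompsonF f) : IsThompsonF f⁻¹ := by
  have hm := hf.strictMono
  have hd := fun d => @IsThompsonF.isDyadic f hf d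
  have hfi : ∀ x, f (f⁻¹ x) = x := fun x => f.apply_symm_apply x
  obtain ⟨h01, S, hS, haff⟩ := hf
  refine ⟨fun x hx => ?_, S.image f, ?_, fun a b hab => ?_⟩
  · apply f.injective
    rw [hfi, h01 x hx]
  · simp only [Finset.mem_image]
    rintro _ ⟨s, hs, rfl⟩
    exact hd s (hS s hs)
  · obtain ⟨k, c, hkc⟩ := haff (f⁻¹ a) (f⁻¹ b) (fun s hs hsab => by
      refine hab (f s) (Finset.mem_image_of_mem _ hs) ⟨?_, ?_⟩
      · simpa [hfi] using hm hsab.1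
      · simpa [hfi] using hm hsab.2)
    refine ⟨-k, -((2 : ℝ) ^ (-k) * c), fun x hx => ?_⟩
    have := hkc (f⁻¹ x) ⟨hm.lt_iff_lt.1 (by simpa [hfi] using hx.1),
      hm.lt_iff_lt.1 (by simpa [hfi] using hx.2)⟩
    rw [hfi] at this
    have h2 : (2 : ℝ) ^ k ≠ 0 := by positivity
    rw [zpow_neg]
    field_simp
    linarith

theorem IsThompsonF.mul {f g : ℝ ≃ₜ ℝ} (hf : IsThompsonF f) (hg : IsThompsonF g) :
    IsThompsonF (f * g) := by
  have hm := hg.strictMono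
  have hd := fun d => @IsThompsonF.isDyadic _ hg.inv d
  have hgi : ∀ x, g (g⁻¹ x) = x := fun x => g.apply_symm_apply x
  have hig : ∀ x, g⁻¹ (g x) = x := fun x => g.symm_apply_apply x
  obtain ⟨f01, S, hS, hfa⟩ := hf
  obtain ⟨g01, T, hT, hga⟩ := hg
  refine ⟨fun x hx => ?_, T ∪ S.image ⇑(g⁻¹), ?_, fun a b hab => ?_⟩
  · change f (g x) = x
    rw [g01 x hx, f01 x hx]
  · simp only [Finset.mem_union, Finset.mem_image]
    rintro s (hs | ⟨s, hs, rfl⟩)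
    · exact hT s hs
    · exact hd s (hS s hs)
  · obtain ⟨k, c, hk⟩ := hga a b (fun s hs => hab s (Finset.mem_union_left _ hs))
    obtain ⟨l, e, hl⟩ := hfa (g a) (g b) (fun s hs hsab => by
      refine hab (g⁻¹ s) (Finset.mem_union_right _ (Finset.mem_image_of_mem _ hs)) ⟨?_, ?_⟩
      · exact hm.lt_iff_lt.1 (by simpa [hgi] using hsab.1)
      · exact hm.lt_iff_lt.1 (by simpa [hgi] using hsab.2))
    refine ⟨l + k, 2 ^ l * c + e, fun x hx => ?_⟩
    change f (g x) = _
    rw [hl (g x) ⟨hm hx.1, hm hx.2⟩, hk x hx, zpow_add₀ (by norm_num)]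
    ring

/-- The copy of Thompson's group `F` in `Homeo(ℝ)` acting on `(0, 1)` and fixing its complement. -/
def thompsonF : Subgroup (ℝ ≃ₜ ℝ) where
  carrier := {f | IsThompsonF f}
  one_mem' := ⟨fun _ _ => rfl, ∅, by simp, fun a b _ => ⟨0, 0, fun x _ => by simp⟩⟩
  mul_mem' := IsThompsonF.mul
  inv_mem' := IsThompsonF.inv

/-! ### The iterated construction inside `Homeo(ℝ)` -/

/-- The intervals: `(0, 1)` at stage `0`, and the support of `t n` at stage `n + 1`. -/
def stageInterval (t : ℕ → ℝ ≃ₜ ℝ) : ℕ → Set ℝ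
  | 0 => Set.Ioo 0 1
  | n + 1 => movedSet (t n)

/-- The groups: Thompson's group at stage `0`, and the subgroup generated by the group of stage `n`
and by `t n` at stage `n + 1`. -/
def stageGroup (t : ℕ → ℝ ≃ₜ ℝ) : ℕ → Subgroup (ℝ ≃ₜ ℝ)
  | 0 => thompsonF
  | n + 1 => Subgroup.closure (insert (t n) (stageGroup t n : Set (ℝ ≃ₜ ℝ)))

/-- The admissible choices in the construction: every `t n` has connected support and displaces the
interval of stage `n`. -/
def IsDisplacingSequence (t : ℕ → ℝ ≃ₜ ℝ) : Prop :=
  ∀ n, IsConnected (movedSet (t n)) ∧ (t n '' stageInterval t n) ∩ stageInterval t n = ∅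

theorem stageGroup_mono (t : ℕ → ℝ ≃ₜ ℝ) : Monotone (stageGroup t) :=
  monotone_nat_of_le_succ fun _ _ hg =>
    Subgroup.subset_closure (Set.mem_insert_of_mem _ hg)

/-- The group `Γ`: the directed union of the groups of all stages. -/
def limitGroup (t : ℕ → ℝ ≃ₜ ℝ) : Subgroup (ℝ ≃ₜ ℝ) := ⨆ n, stageGroup t n

theorem mem_limitGroup (t : ℕ → ℝ ≃ₜ ℝ) (g : ℝ ≃ₜ ℝ) :
    g ∈ limitGroup t ↔ ∃ n, g ∈ stageGroup t n :=
  Subgroup.mem_iSup_of_directed (stageGroup_mono t).directed_le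

open Set Filter Topology

/-! ### Homeomorphisms with disjoint supports -/

/-! Since `t n` has connected support, it pushes all points in one direction, so every nonzero power
of it displaces the interval `I` of stage `n`. As the group of stage `n` is supported on `I`,
commuting ℤ-conjugates follow from disjointness of supports. Moreover the group of stage `n + 1`
acts on the translates of `I` like a restricted wreath product of the group of stage `n` with ℤ.

Not binate, not dissipated: in groups of either kind every element is a single commutator. In `Γ`
some element is not. The logarithm of the slope at `0` is a homomorphism from `F` to ℤ that is
nonzero on `dyadicBump`, and it extends from each stage to the next by summing over the wreath
coordinates (`exists_monoidHom_extension`). A commutator expression in `Γ` lives in one stage, where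
such a homomorphism kills it.

No conjugates in commuting ℤ-conjugate: let `τ` be the conjugator, in stage `n`, and let `s Λ s⁻¹`
contain `dyadicBump`, `t 0` and `t n`. Put `σ = s τ s⁻¹`. The relation for `t n` forces `σ` to
centralize stage `n + 1` (`commute_conj`); the relation between `dyadicBump` and `t 0` then says
that these two commute, which is false. -/

theorem Homeomorph.commute_of_disjoint_support {X : Type*} [TopologicalSpace X] {f g : X ≃ₜ X}
    (h : ∀ x, f x = x ∨ g x = x) : Commute f g := by
  ext x
  change f (g x) = g (f x)
  rcases h x with hx | hx
  · rw [hx]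
    rcases h (g x) with h' | h'
    · exact h'
    · rw [g.injective h', hx]
  · rw [hx]
    rcases h (f x) with h' | h'
    · rw [f.injective h', hx]
    · exact h'.symm

theorem Homeomorph.zpow_add_apply {X : Type*} [TopologicalSpace X] (T : X ≃ₜ X) (p q : ℤ) (x : X) :
    (T ^ (p + q)) x = (T ^ p) ((T ^ q) x) := by
  rw [zpow_add]; rfl

/-- All nontrivial powers of `T` displace the set `I`. -/
def DisplacesByPowers {X : Type*} [TopologicalSpace X] (T : X ≃ₜ X) (I : Set X) : Prop :=
  ∀ p : ℤ, p ≠ 0 → ∀ x ∈ I, (T ^ p) x ∉ I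

theorem DisplacesByPowers.eq_of_zpow_eq {X : Type*} [TopologicalSpace X] {T : X ≃ₜ X} {I : Set X}
    (h : DisplacesByPowers T I) {p q : ℤ} {x y : X} (hx : x ∈ I) (hy : y ∈ I)
    (hxy : (T ^ p) x = (T ^ q) y) : p = q ∧ x = y := by
  have hpq : p = q := by
    by_contra hne
    refine h (p - q) (sub_ne_zero.2 hne) x hx ?_
    have : (T ^ (p - q)) x = y := by
      rw [sub_eq_neg_add, T.zpow_add_apply, hxy, ← T.zpow_add_apply]
      simp
    rwa [this]
  exact ⟨hpq, (T ^ q).injective (by rw [← hxy, hpq])⟩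

theorem DisplacesByPowers.inv {X : Type*} [TopologicalSpace X] {T : X ≃ₜ X} {I : Set X}
    (h : DisplacesByPowers T⁻¹ I) : DisplacesByPowers T I := fun p hp x hx => by
  have := h (-p) (neg_ne_zero.2 hp) x hx
  simpa using this

/-- If `x` and a higher iterate of `x` were both in `I`, then `T x`, which lies between them, would
be in `I` by convexity. Negative powers reduce to positive ones. -/
theorem displacesByPowers_of_le {T : ℝ ≃ₜ ℝ} (hT : ∀ x, x ≤ T x) {I : Set ℝ} (hI : I.OrdConnected)
    (hd : ∀ x ∈ I, T x ∉ I) : DisplacesByPowers T I := by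
  have key : ∀ n : ℕ, ∀ x, T x ≤ (T ^ (n + 1)) x := by
    intro n
    induction n with
    | zero => intro x; simp
    | succ n ih =>
      intro x
      rw [pow_succ']
      exact (ih x).trans (hT _)
  have pos : ∀ n : ℕ, ∀ x ∈ I, (T ^ (n + 1)) x ∉ I := fun n x hx h =>
    hd x hx (hI.out hx h ⟨hT x, key n x⟩)
  intro p hp x hx
  rcases lt_or_gt_of_ne hp with hneg | hpos
  · obtain ⟨n, rfl⟩ : ∃ n : ℕ, p = -((n : ℤ) + 1) := ⟨(-p - 1).toNat, by omega⟩
    intro h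
    refine pos n _ h ?_
    have : (T ^ (n + 1)) ((T ^ (-((n : ℤ) + 1))) x) = x := by
      rw [← zpow_natCast, ← T.zpow_add_apply]
      simp
    rwa [this]
  · obtain ⟨n, rfl⟩ : ∃ n : ℕ, p = (n : ℤ) + 1 := ⟨(p - 1).toNat, by omega⟩
    exact_mod_cast pos n x hx

/-- On the connected support `T x - x` never vanishes, so by the intermediate value theorem it has
constant sign; after replacing `T` by its inverse if necessary, `T` moves points upwards. -/
theorem displacesByPowers_of_isConnected {T : ℝ ≃ₜ ℝ} (hT : IsConnected (movedSet T)) {I : Set ℝ}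
    (hI : I.OrdConnected) (hd : (T '' I) ∩ I = ∅) : DisplacesByPowers T I := by
  have hd' : ∀ x ∈ I, T x ∉ I := fun x hx h =>
    Set.disjoint_left.1 (Set.disjoint_iff_inter_eq_empty.2 hd) (mem_image_of_mem _ hx) h
  have hsign : (∀ x, x ≤ T x) ∨ ∀ x, T x ≤ x := by
    by_contra! hcon
    obtain ⟨⟨x, hx⟩, y, hy⟩ := hcon
    have hO := hT.isPreconnected.image (fun z => T z - z)
      (T.continuous.sub continuous_id).continuousOn
    obtain ⟨z, hz, hz0⟩ := hO.ordConnected.out (mem_image_of_mem _ (show x ∈ movedSet T from hx.ne))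
      (mem_image_of_mem _ (show y ∈ movedSet T from hy.ne'))
      (show (0 : ℝ) ∈ Icc (T x - x) (T y - y) from ⟨by linarith, by linarith⟩)
    exact hz (sub_eq_zero.1 hz0)
  rcases hsign with h | h
  · exact displacesByPowers_of_le h hI hd'
  · refine DisplacesByPowers.inv (displacesByPowers_of_le (fun x => ?_) hI fun x hx hx' => ?_)
    · simpa using h (T⁻¹ x)
    · exact hd' _ hx' (by simpa using hx)

/-! ### Wreath product decompositions -/

/-- On the translates `T ^ p I`, the map `g` acts as `T ^ (p + k) (c p) T ^ (-p)`, with `c` finitely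
supported. -/
def IsWreathDecomposition {X : Type*} [TopologicalSpace X] (T : X ≃ₜ X) (G : Subgroup (X ≃ₜ X))
    (I : Set X) (g : X ≃ₜ X) (k : ℤ) (c : ℤ → G) : Prop :=
  Function.HasFiniteMulSupport c ∧
    ∀ p : ℤ, ∀ x ∈ I, g ((T ^ p) x) = (T ^ (p + k)) ((c p : X ≃ₜ X) x)

section Wreath

variable {X : Type*} [TopologicalSpace X] {T : X ≃ₜ X} {G : Subgroup (X ≃ₜ X)} {I : Set X}

theorem mem_of_supportedOn (hG : ∀ g ∈ G, ∀ x, x ∉ I → g x = x) {g : X ≃ₜ X} (hg : g ∈ G) {x : X}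
    (hx : x ∈ I) : g x ∈ I := by
  by_contra h
  have := hG g hg _ h
  rw [g.injective this] at h
  exact h hx

/-- The factor `g'` carries the translate of index `p` to that of index `p + k'`, so `g` then acts
through its coordinate there. -/
theorem IsWreathDecomposition.mul (hG : ∀ g ∈ G, ∀ x, x ∉ I → g x = x) {g g' : X ≃ₜ X} {k k' : ℤ}
    {c c' : ℤ → G} (h : IsWreathDecomposition T G I g k c)
    (h' : IsWreathDecomposition T G I g' k' c') :
    IsWreathDecomposition T G I (g * g') (k' + k) fun p => c (p + k') * c' p := by
  refine ⟨?_, fun p x hx => ?_⟩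
  · refine Function.HasFiniteMulSupport.mul ?_ h'.1
    exact Set.Finite.preimage (f := fun p : ℤ => p + k') (add_left_injective k').injOn h.1
  · change g (g' _) = _
    rw [h'.2 p x hx, h.2 (p + k') _ (mem_of_supportedOn hG (c' p).2 hx), add_assoc]
    rfl

theorem IsWreathDecomposition.inv (hG : ∀ g ∈ G, ∀ x, x ∉ I → g x = x) {g : X ≃ₜ X} {k : ℤ}
    {c : ℤ → G} (h : IsWreathDecomposition T G I g k c) :
    IsWreathDecomposition T G I g⁻¹ (-k) fun p => (c (p - k))⁻¹ := by
  refine ⟨?_, fun p x hx => ?_⟩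
  · refine Function.HasFiniteMulSupport.inv ?_
    exact Set.Finite.preimage (f := fun p : ℤ => p - k) (sub_left_injective).injOn h.1
  · apply g.injective
    rw [← sub_eq_add_neg, h.2 (p - k) _ (mem_of_supportedOn hG ((c (p - k))⁻¹).2 hx)]
    simp

theorem isWreathDecomposition_self : IsWreathDecomposition T G I T 1 1 :=
  ⟨by simp [Function.HasFiniteMulSupport], fun p x _ => by
    rw [add_comm, T.zpow_add_apply]; simp⟩

theorem isWreathDecomposition_of_mem (hG : ∀ g ∈ G, ∀ x, x ∉ I → g x = x)
    (hT : DisplacesByPowers T I) (g : G) :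
    IsWreathDecomposition T G I g 0 (Pi.mulSingle 0 g) := by
  refine ⟨(Set.finite_singleton 0).subset Pi.mulSupport_mulSingle_subset, fun p x hx => ?_⟩
  by_cases hp : p = 0
  · subst hp; simp
  · rw [Pi.mulSingle_eq_of_ne hp, hG g g.2 _ (hT p hp x hx)]; simp

theorem exists_isWreathDecomposition (hG : ∀ g ∈ G, ∀ x, x ∉ I → g x = x)
    (hT : DisplacesByPowers T I) {g : X ≃ₜ X}
    (hg : g ∈ Subgroup.closure (insert T (G : Set (X ≃ₜ X)))) :
    ∃ k c, IsWreathDecomposition T G I g k c := by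
  induction hg using Subgroup.closure_induction with
  | mem x hx =>
    rcases hx with rfl | hx
    · exact ⟨_, _, isWreathDecomposition_self⟩
    · exact ⟨_, _, isWreathDecomposition_of_mem hG hT ⟨x, hx⟩⟩
  | one => exact ⟨_, _, isWreathDecomposition_of_mem hG hT 1⟩
  | mul x y _ _ hx hy =>
    obtain ⟨k, c, h⟩ := hx
    obtain ⟨k', c', h'⟩ := hy
    exact ⟨_, _, h.mul hG h'⟩
  | inv x _ hx =>
    obtain ⟨k, c, h⟩ := hx
    exact ⟨_, _, h.inv hG⟩

/-- Translates of `I` by distinct powers are disjoint, so the action of `g` on them determines the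
shift, and the coordinates on `I`; off `I` the coordinates are trivial. -/
theorem IsWreathDecomposition.unique (hG : ∀ g ∈ G, ∀ x, x ∉ I → g x = x)
    (hT : DisplacesByPowers T I) (hI : I.Nonempty) {g : X ≃ₜ X} {k k' : ℤ} {c c' : ℤ → G}
    (h : IsWreathDecomposition T G I g k c) (h' : IsWreathDecomposition T G I g k' c') :
    k = k' ∧ c = c' := by
  have key : ∀ p, ∀ x ∈ I, p + k = p + k' ∧ (c p : X ≃ₜ X) x = (c' p : X ≃ₜ X) x := fun p x hx =>
    hT.eq_of_zpow_eq (mem_of_supportedOn hG (c p).2 hx) (mem_of_supportedOn hG (c' p).2 hx)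
      ((h.2 p x hx).symm.trans (h'.2 p x hx))
  obtain ⟨x, hx⟩ := hI
  refine ⟨by simpa using (key 0 x hx).1, funext fun p => Subtype.ext (Homeomorph.ext fun y => ?_)⟩
  by_cases hy : y ∈ I
  · exact (key p y hy).2
  · rw [hG _ (c p).2 y hy, hG _ (c' p).2 y hy]

/-- A homomorphism from `G` to a commutative group extends to the group generated by `G` and `T`. -/
theorem exists_monoidHom_extension (hG : ∀ g ∈ G, ∀ x, x ∉ I → g x = x)
    (hT : DisplacesByPowers T I) (hI : I.Nonempty) {A : Type*} [CommGroup A] (φ : G →* A) :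
    ∃ ψ : Subgroup.closure (insert T (G : Set (X ≃ₜ X))) →* A,
      ∀ (g : X ≃ₜ X) (hg : g ∈ G),
        ψ ⟨g, Subgroup.subset_closure (mem_insert_of_mem _ hg)⟩ = φ ⟨g, hg⟩ := by
  choose k c hkc using fun g : Subgroup.closure (insert T (G : Set (X ≃ₜ X))) =>
    exists_isWreathDecomposition hG hT g.2
  have hfin : ∀ g, Function.HasFiniteMulSupport fun p => φ (c g p) := fun g =>
    (hkc g).1.subset fun p hp h => hp (by simp [h])
  -- The product of `φ` over all coordinates. Multiplication in the wreath product shifts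
  -- coordinates, which a product in a commutative group does not see.
  refine ⟨MonoidHom.mk' (fun g => ∏ᶠ p, φ (c g p)) fun g g' => ?_, fun g hg => ?_⟩
  · have hc : c (g * g') = fun p => c g (p + k g') * c g' p :=
      ((hkc (g * g')).unique hG hT hI ((hkc g).mul hG (hkc g'))).2
    simp only [hc, map_mul]
    rw [finprod_mul_distrib _ (hfin g')]
    · congr 1
      exact finprod_comp_equiv (Equiv.addRight (k g')) (f := fun p => φ (c g p))
    · exact Set.Finite.preimage (f := fun p : ℤ => p + k g') (add_left_injective _).injOn (hfin g)
  · have hc := ((hkc ⟨g, Subgroup.subset_closure (mem_insert_of_mem _ hg)⟩).unique hG hT hI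
      (isWreathDecomposition_of_mem hG hT ⟨g, hg⟩)).2
    change ∏ᶠ p, φ (c _ p) = _
    rw [hc, finprod_eq_single _ 0 fun p hp => by rw [Pi.mulSingle_eq_of_ne hp, map_one]]
    simp

end Wreath

/-! ### An element of Thompson's group and its germ at `0` -/

/-- The element of Thompson's group `F` that is affine on `[0, 1/4]`, `[1/4, 1/2]` and `[1/2, 1]`,
with slopes `2`, `1` and `1/2`. -/
noncomputable def dyadicBump : ℝ ≃ₜ ℝ where
  toFun x := max x (min (2 * x) (min (x + 1 / 4) ((x + 1) / 2)))
  invFun y := min y (max (y / 2) (max (y - 1 / 4) (2 * y - 1)))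
  left_inv x := by grind
  right_inv y := by grind
  continuous_toFun := by fun_prop
  continuous_invFun := by fun_prop

theorem dyadicBump_apply (x : ℝ) :
    dyadicBump x = max x (min (2 * x) (min (x + 1 / 4) ((x + 1) / 2))) := rfl

theorem movedSet_dyadicBump : movedSet dyadicBump = Ioo 0 1 := by
  ext x
  change dyadicBump x ≠ x ↔ _
  rw [dyadicBump_apply, mem_Ioo]
  grind

theorem dyadicBump_notMem {x : ℝ} (hx : x ∈ Ioo (1 / 4 : ℝ) (1 / 2)) :
    dyadicBump x ∉ Ioo (1 / 4 : ℝ) (1 / 2) := by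
  rw [dyadicBump_apply]
  grind

theorem dyadicBump_mem_thompsonF : dyadicBump ∈ thompsonF := by
  refine ⟨fun x hx => ?_, {0, 1 / 4, 1 / 2, 1}, ?_, fun a b hab => ?_⟩
  · by_contra h
    exact hx (movedSet_dyadicBump ▸ h)
  · simp only [Finset.mem_insert, Finset.mem_singleton]
    rintro s (rfl | rfl | rfl | rfl)
    · exact isDyadic_zero
    · exact ⟨1, 2, by norm_num⟩
    · exact ⟨1, 1, by norm_num⟩
    · exact ⟨1, 0, by norm_num⟩
  · simp only [Finset.mem_insert, Finset.mem_singleton, forall_eq_or_imp, forall_eq, mem_Ioo,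
      not_and_or, not_lt] at hab
    simp only [dyadicBump_apply, mem_Ioo]
    obtain ⟨h0, h1, h2, h3⟩ := hab
    have aff : ∀ (k : ℤ) (m c : ℝ), (2 : ℝ) ^ k = m → (∀ x, a < x ∧ x < b →
        max x (min (2 * x) (min (x + 1 / 4) ((x + 1) / 2))) = m * x + c) →
        ∃ (k : ℤ) (c : ℝ), ∀ x, a < x ∧ x < b →
          max x (min (2 * x) (min (x + 1 / 4) ((x + 1) / 2))) = 2 ^ k * x + c :=
      fun k m c hk h => ⟨k, c, hk ▸ h⟩
    rcases h0 with h0 | h0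
    · rcases h1 with h1 | h1
      · rcases h2 with h2 | h2
        · rcases h3 with h3 | h3
          · exact aff 0 1 0 (by norm_num) fun x hx => by grind
          · exact aff (-1) (1 / 2) (1 / 2) (by norm_num) fun x hx => by grind
        · exact aff 0 1 (1 / 4) (by norm_num) fun x hx => by grind
      · exact aff 1 2 0 (by norm_num) fun x hx => by grind
    · exact aff 0 1 0 (by norm_num) fun x hx => by grind

theorem IsThompsonF.exists_germ_zero {f : ℝ ≃ₜ ℝ} (hf : IsThompsonF f) :
    ∃ k : ℤ, ∀ᶠ x in 𝓝[>] (0 : ℝ), f x = 2 ^ k * x := by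
  have hf0 : f 0 = 0 := hf.1 0 (by simp)
  obtain ⟨-, S, -, haff⟩ := hf
  have hS : ∀ᶠ ε in 𝓝[>] (0 : ℝ), ∀ s ∈ S, s ∉ Ioo 0 ε := by
    rw [eventually_all_finset]
    intro s _
    rcases le_or_gt s 0 with hs | hs
    · exact Eventually.of_forall fun ε h => absurd h.1 (not_lt.2 hs)
    · filter_upwards [Ioo_mem_nhdsGT hs] with ε hε h
      exact absurd h.2 (not_lt.2 hε.2.le)
  obtain ⟨ε, hε, hε0⟩ := (hS.and self_mem_nhdsWithin).exists
  obtain ⟨k, c, hkc⟩ := haff 0 ε hε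
  have hcl : EqOn f (fun x => (2 : ℝ) ^ k * x + c) (closure (Ioo 0 ε)) :=
    EqOn.closure hkc f.continuous (by fun_prop)
  rw [closure_Ioo (ne_of_lt hε0)] at hcl
  have hc : f 0 = 2 ^ k * 0 + c := hcl ⟨le_rfl, le_of_lt hε0⟩
  rw [hf0, mul_zero, zero_add] at hc
  refine ⟨k, ?_⟩
  filter_upwards [Ioo_mem_nhdsGT hε0] with x hx
  rw [hkc x hx, ← hc, add_zero]

theorem eq_of_germ_zero_eq {f : ℝ → ℝ} {k l : ℤ} (hk : ∀ᶠ x in 𝓝[>] (0 : ℝ), f x = 2 ^ k * x)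
    (hl : ∀ᶠ x in 𝓝[>] (0 : ℝ), f x = 2 ^ l * x) : k = l := by
  obtain ⟨x, ⟨h1, h2⟩, hx⟩ := ((hk.and hl).and self_mem_nhdsWithin).exists
  have : (2 : ℝ) ^ k = 2 ^ l := mul_right_cancel₀ (ne_of_gt hx) (h1.symm.trans h2)
  exact zpow_right_injective₀ (by norm_num) (by norm_num) this

/-- The exponent of the slope at `0` from the right is additive by the chain rule, and `dyadicBump`
has slope `2` there. -/
theorem exists_monoidHom_thompsonF :
    ∃ φ : thompsonF →* Multiplicative ℤ, φ ⟨dyadicBump, dyadicBump_mem_thompsonF⟩ ≠ 1 := by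
  choose k hk using fun f : thompsonF => IsThompsonF.exists_germ_zero f.2
  refine ⟨MonoidHom.mk' (fun f => Multiplicative.ofAdd (k f)) fun f g => ?_, fun h => ?_⟩
  · rw [← ofAdd_add]
    congr 1
    refine eq_of_germ_zero_eq (hk (f * g)) ?_
    have hlim : Tendsto (fun x : ℝ => (2 : ℝ) ^ k g * x) (𝓝[>] 0) (𝓝[>] 0) := by
      refine tendsto_nhdsWithin_iff.2 ⟨?_, ?_⟩
      · refine Tendsto.mono_left ?_ nhdsWithin_le_nhds
        simpa using (continuous_const_mul ((2 : ℝ) ^ k g)).tendsto 0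
      · filter_upwards [self_mem_nhdsWithin] with x hx
        exact mul_pos (zpow_pos (two_pos : (0 : ℝ) < 2) (k g)) (mem_Ioi.1 hx)
    filter_upwards [hk g, hlim.eventually (hk f)] with x hx hx'
    change (f : ℝ ≃ₜ ℝ) ((g : ℝ ≃ₜ ℝ) x) = _
    rw [hx, hx', zpow_add₀ (by norm_num), mul_assoc]
  · have h0 : k ⟨dyadicBump, dyadicBump_mem_thompsonF⟩ = 0 := h
    have h1 : k ⟨dyadicBump, dyadicBump_mem_thompsonF⟩ = 1 := by
      refine eq_of_germ_zero_eq (hk _) ?_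
      filter_upwards [Ioo_mem_nhdsGT (show (0 : ℝ) < 1 / 4 by norm_num)] with x hx
      rw [dyadicBump_apply, zpow_one]
      grind
    omega

/-! ### Existence of displacing sequences -/

/-- The conjugate of `dyadicBump` by the affine map sending `(0, 1)` to `(a, a + L)`. -/
noncomputable def scaledBump (a L : ℝ) (hL : L ≠ 0) : ℝ ≃ₜ ℝ :=
  (affineHomeomorph L a hL).symm.trans (dyadicBump.trans (affineHomeomorph L a hL))

theorem scaledBump_apply {a L : ℝ} (hL : L ≠ 0) (x : ℝ) :
    scaledBump a L hL x = L * dyadicBump ((x - a) / L) + a := rfl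

theorem movedSet_scaledBump {a L : ℝ} (hL : 0 < L) :
    movedSet (scaledBump a L hL.ne') = Ioo a (a + L) := by
  ext x
  have h : (x - a) / L ∈ movedSet dyadicBump ↔ (x - a) / L ∈ Ioo (0 : ℝ) 1 := by
    rw [movedSet_dyadicBump]
  rw [mem_Ioo, div_pos_iff_of_pos_right hL, div_lt_one hL, sub_pos, sub_lt_iff_lt_add'] at h
  rw [mem_Ioo, ← h]
  refine not_congr ?_
  rw [scaledBump_apply, ← eq_sub_iff_add_eq, eq_div_iff hL.ne', mul_comm]

theorem scaledBump_notMem {a L : ℝ} (hL : 0 < L) {x : ℝ} (hx : x ∈ Ioo (a + L / 4) (a + L / 2)) :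
    scaledBump a L hL.ne' x ∉ Ioo (a + L / 4) (a + L / 2) := by
  have h := dyadicBump_notMem (x := (x - a) / L)
    ⟨by rw [lt_div_iff₀ hL]; linarith [hx.1], by rw [div_lt_iff₀ hL]; linarith [hx.2]⟩
  rw [scaledBump_apply]
  rintro ⟨h1, h2⟩
  exact h ⟨by nlinarith, by nlinarith⟩

theorem exists_isDisplacingSequence : ∃ t : ℕ → ℝ ≃ₜ ℝ, IsDisplacingSequence t := by
  have hL : ∀ n : ℕ, (0 : ℝ) < 4 ^ n := fun n => by positivity
  -- Chosen so that the interval of stage `n` is the second quarter of the next one, which the bump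
  -- displaces: `a 0 = 0` and `a n = a (n + 1) + 4 ^ n`.
  set a : ℕ → ℝ := fun n => (1 - 4 ^ n) / 3 with ha
  set t : ℕ → ℝ ≃ₜ ℝ := fun n => scaledBump (a (n + 1)) (4 ^ (n + 1)) (hL _).ne' with ht
  have hI : ∀ n, stageInterval t n = Ioo (a n) (a n + 4 ^ n) := by
    rintro (_ | n)
    · simp [stageInterval, ha]
    · exact movedSet_scaledBump (hL _)
  refine ⟨t, fun n => ⟨?_, ?_⟩⟩
  · change IsConnected (stageInterval t (n + 1))
    rw [hI]
    exact isConnected_Ioo (by linarith [hL (n + 1)])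
  · have e1 : a n = a (n + 1) + 4 ^ (n + 1) / 4 := by simp only [ha, pow_succ]; ring
    have e2 : a n + 4 ^ n = a (n + 1) + 4 ^ (n + 1) / 2 := by simp only [ha, pow_succ]; ring
    rw [hI, e2, e1, ← Set.disjoint_iff_inter_eq_empty, Set.disjoint_left]
    rintro _ ⟨x, hx, rfl⟩
    exact scaledBump_notMem (hL _) hx

/-! ### Structure of the limit group -/

namespace IsDisplacingSequence

variable {t : ℕ → ℝ ≃ₜ ℝ}

theorem isConnected_stageInterval (ht : IsDisplacingSequence t) :
    ∀ n, IsConnected (stageInterval t n)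
  | 0 => isConnected_Ioo zero_lt_one
  | n + 1 => (ht n).1

theorem displacesByPowers (ht : IsDisplacingSequence t) (n : ℕ) :
    DisplacesByPowers (t n) (stageInterval t n) :=
  displacesByPowers_of_isConnected (ht n).1
    (ht.isConnected_stageInterval n).isPreconnected.ordConnected (ht n).2

theorem apply_notMem (ht : IsDisplacingSequence t) {n : ℕ} {x : ℝ} (hx : x ∈ stageInterval t n) :
    t n x ∉ stageInterval t n := by
  simpa using ht.displacesByPowers n 1 one_ne_zero x hx

theorem stageInterval_mono (ht : IsDisplacingSequence t) : Monotone (stageInterval t) :=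
  monotone_nat_of_le_succ fun n x hx h => ht.apply_notMem hx (by rwa [h])

theorem supportedOn (ht : IsDisplacingSequence t) (n : ℕ) :
    ∀ g ∈ stageGroup t n, ∀ x, x ∉ stageInterval t n → g x = x := by
  induction n with
  | zero => exact fun g hg x hx => hg.1 x hx
  | succ n ih =>
    intro g hg x hx
    induction hg using Subgroup.closure_induction with
    | mem g hg =>
      rcases hg with rfl | hg
      · exact not_not.1 hx
      · exact ih g hg x fun h => hx (ht.stageInterval_mono n.le_succ h)
    | one => rfl
    | mul g g' _ _ h h' => exact (congrArg g h').trans h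
    | inv g _ h => exact g.injective (by rw [h]; exact g.apply_symm_apply x)

theorem exists_isWreathDecomposition (ht : IsDisplacingSequence t) {n : ℕ} {g : ℝ ≃ₜ ℝ}
    (hg : g ∈ stageGroup t (n + 1)) :
    ∃ k c, IsWreathDecomposition (t n) (stageGroup t n) (stageInterval t n) g k c :=
  _root_.exists_isWreathDecomposition (ht.supportedOn n) (ht.displacesByPowers n) hg

/-- An element of `Γ` that does not displace the interval of stage `n` acts on it as an element of
the group of stage `n`. -/
theorem exists_eqOn_stageInterval (ht : IsDisplacingSequence t) {n m : ℕ} (hnm : n ≤ m)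
    {g : ℝ ≃ₜ ℝ} (hg : g ∈ stageGroup t m) {x : ℝ} (hx : x ∈ stageInterval t n)
    (hgx : g x ∈ stageInterval t n) :
    ∃ c ∈ stageGroup t n, EqOn g c (stageInterval t n) := by
  induction m, hnm using Nat.le_induction generalizing g with
  | base => exact ⟨g, hg, fun _ _ => rfl⟩
  | succ m hnm ih =>
    obtain ⟨k, c, -, hc⟩ := ht.exists_isWreathDecomposition hg
    have hle := ht.stageInterval_mono hnm
    have hc0 : ∀ y ∈ stageInterval t m, g y = (t m ^ k) ((c 0 : ℝ ≃ₜ ℝ) y) := fun y hy => by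
      simpa using hc 0 y hy
    -- A nonzero shift would carry the interval of stage `m` off itself, yet `g` keeps `x` inside
    -- it.
    have hk : k = 0 := by
      by_contra hk
      refine ht.displacesByPowers m k hk _
        (mem_of_supportedOn (ht.supportedOn m) (c 0).2 (hle hx)) ?_
      rw [← hc0 x (hle hx)]
      exact hle hgx
    subst hk
    have hgc : EqOn g (c 0 : ℝ ≃ₜ ℝ) (stageInterval t m) := fun y hy => by simpa using hc0 y hy
    obtain ⟨d, hd, hcd⟩ := ih (c 0).2 (by rwa [← hgc (hle hx)])
    exact ⟨d, hd, fun y hy => (hgc (hle hy)).trans (hcd hy)⟩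

theorem exists_monoidHom_stageGroup (ht : IsDisplacingSequence t) (n : ℕ) :
    ∃ φ : stageGroup t n →* Multiplicative ℤ,
      φ ⟨dyadicBump, stageGroup_mono t n.zero_le dyadicBump_mem_thompsonF⟩ ≠ 1 := by
  induction n with
  | zero => exact exists_monoidHom_thompsonF
  | succ n ih =>
    obtain ⟨φ, hφ⟩ := ih
    obtain ⟨ψ, hψ⟩ := exists_monoidHom_extension (ht.supportedOn n) (ht.displacesByPowers n)
      (ht.isConnected_stageInterval n).nonempty φ
    exact ⟨ψ, fun h => hφ ((hψ _ _).symm.trans h)⟩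

theorem exists_ne_commutatorElement (ht : IsDisplacingSequence t) :
    ∃ h : limitGroup t, ∀ a b : limitGroup t, h ≠ a * b * a⁻¹ * b⁻¹ := by
  refine ⟨⟨dyadicBump, (mem_limitGroup t _).2 ⟨0, dyadicBump_mem_thompsonF⟩⟩, ?_⟩
  rintro ⟨a, ha⟩ ⟨b, hb⟩ hab
  obtain ⟨m, ha⟩ := (mem_limitGroup t a).1 ha
  obtain ⟨n, hb⟩ := (mem_limitGroup t b).1 hb
  obtain ⟨φ, hφ⟩ := ht.exists_monoidHom_stageGroup (max m n)
  let a' : stageGroup t (max m n) := ⟨a, stageGroup_mono t (le_max_left _ _) ha⟩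
  let b' : stageGroup t (max m n) := ⟨b, stageGroup_mono t (le_max_right _ _) hb⟩
  have key : (⟨dyadicBump, stageGroup_mono t (max m n).zero_le dyadicBump_mem_thompsonF⟩ :
      stageGroup t (max m n)) = a' * b' * a'⁻¹ * b'⁻¹ :=
    Subtype.ext (congrArg (Subtype.val : limitGroup t → ℝ ≃ₜ ℝ) hab :)
  refine hφ ?_
  rw [key]
  simp only [map_mul, map_inv]
  rw [mul_right_comm (φ a')]
  simp

/-- The point `1 / 2` is moved by `dyadicBump`, while its image under `t 0` is fixed. -/
theorem not_commute_dyadicBump (ht : IsDisplacingSequence t) : ¬ Commute dyadicBump (t 0) := by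
  intro h
  have hx : (1 / 2 : ℝ) ∈ movedSet dyadicBump := by
    rw [movedSet_dyadicBump]; norm_num
  have hx0 : (1 / 2 : ℝ) ∈ stageInterval t 0 := movedSet_dyadicBump.subset hx
  have h1 : dyadicBump (t 0 (1 / 2)) = t 0 (dyadicBump (1 / 2)) := congrArg (· (1 / 2)) h.eq
  rw [dyadicBump_mem_thompsonF.1 _ (ht.apply_notMem hx0)] at h1
  exact hx ((t 0).injective h1).symm

theorem exists_mem_stageGroup_of_fg (t : ℕ → ℝ ≃ₜ ℝ) {H : Subgroup (limitGroup t)} (hH : H.FG) :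
    ∃ n, ∀ h ∈ H, (h : ℝ ≃ₜ ℝ) ∈ stageGroup t n := by
  obtain ⟨S, rfl⟩ := hH
  choose N hN using fun g : limitGroup t => (mem_limitGroup t g).1 g.2
  refine ⟨S.sup N, fun h hh => ?_⟩
  have : Subgroup.closure (S : Set (limitGroup t)) ≤
      (stageGroup t (S.sup N)).comap (limitGroup t).subtype :=
    (Subgroup.closure_le _).2 fun g hg => stageGroup_mono t (Finset.le_sup hg) (hN g)
  exact this hh

theorem mem_limitGroup_apply (t : ℕ → ℝ ≃ₜ ℝ) (n : ℕ) : t n ∈ limitGroup t :=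
  (mem_limitGroup t _).2 ⟨n + 1, Subgroup.subset_closure (mem_insert _ _)⟩

theorem hasCommutingZConjugates (ht : IsDisplacingSequence t) :
    HasCommutingZConjugates (limitGroup t) := by
  intro H hH
  obtain ⟨n, hn⟩ := exists_mem_stageGroup_of_fg t hH
  refine ⟨⟨t n, mem_limitGroup_apply t n⟩, fun p hp h hh k hk => Subtype.ext ?_⟩
  refine (Homeomorph.commute_of_disjoint_support fun x => ?_ :
    Commute (h : ℝ ≃ₜ ℝ) (t n ^ p * k * (t n ^ p)⁻¹)).eq
  by_cases hx : x ∈ stageInterval t n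
  · refine Or.inr ?_
    have h1 : (t n ^ p)⁻¹ x ∉ stageInterval t n := by
      have := ht.displacesByPowers n (-p) (by omega) x hx
      rwa [zpow_neg, zpow_natCast] at this
    change (t n ^ p) ((k : ℝ ≃ₜ ℝ) ((t n ^ p)⁻¹ x)) = x
    rw [ht.supportedOn n _ (hn k hk) _ h1]
    exact (t n ^ p).apply_symm_apply x
  · exact Or.inl (ht.supportedOn n _ (hn h hh) x hx)

/-- If `τ` belongs to the group of stage `n` and its conjugate by `s` satisfies the commutation
relation with `t n`, then that conjugate commutes with the group of stage `n + 1`. -/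
theorem commute_conj (ht : IsDisplacingSequence t) {n : ℕ} {τ s : ℝ ≃ₜ ℝ}
    (hτ : τ ∈ stageGroup t n) (hs : s ∈ limitGroup t)
    (hcomm : Commute (t n) ((s * τ * s⁻¹) * t n * (s * τ * s⁻¹)⁻¹)) {g : ℝ ≃ₜ ℝ}
    (hg : g ∈ stageGroup t (n + 1)) : Commute (s * τ * s⁻¹) g := by
  set σ := s * τ * s⁻¹ with hσ
  have hmoved : ∀ x, σ x ≠ x → s⁻¹ x ∈ stageInterval t n := fun x hx => by
    by_contra h
    refine hx ?_
    change s (τ (s⁻¹ x)) = x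
    rw [ht.supportedOn n τ hτ _ h]
    exact s.apply_symm_apply x
  have hss : ∀ x, s (s⁻¹ x) = x := s.apply_symm_apply
  obtain ⟨m, hm⟩ := (mem_limitGroup t s).1 hs
  -- The support of `σ` lies in the image under `s` of the interval of stage `n`. Either this image
  -- misses the interval of stage `n + 1`, and supports are disjoint, or it is a single translate by
  -- a power of `t n`, and then `σ = 1`.
  by_cases hcase : ∃ x ∈ stageInterval t n, s x ∈ stageInterval t (n + 1)
  · obtain ⟨x, hx, hsx⟩ := hcase
    have hle := ht.stageInterval_mono n.le_succ
    obtain ⟨c, hc, hsc⟩ := ht.exists_eqOn_stageInterval (le_max_left (n + 1) m)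
      (stageGroup_mono t (le_max_right _ _) hm) (hle hx) hsx
    obtain ⟨k, d, -, hd⟩ := ht.exists_isWreathDecomposition hc
    have htrans : ∀ y, σ y ≠ y → ∃ z ∈ stageInterval t n, y = (t n ^ k) z := fun y hy =>
      ⟨_, mem_of_supportedOn (ht.supportedOn n) (d 0).2 (hmoved y hy), by
        have := hd 0 _ (hmoved y hy)
        rw [zero_add] at this
        rw [← this, zpow_zero]
        exact ((hss y).symm.trans (hsc (hle (hmoved y hy))))⟩
    have hfix : ∀ y, σ y ≠ y → ∀ p : ℤ, p ≠ 0 → σ ((t n ^ p) y) = (t n ^ p) y := by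
      intro y hy p hp
      by_contra h
      obtain ⟨z, hz, rfl⟩ := htrans y hy
      obtain ⟨w, hw, hzw⟩ := htrans _ h
      rw [← (t n).zpow_add_apply] at hzw
      have := ((ht.displacesByPowers n).eq_of_zpow_eq hz hw hzw).1
      omega
    have hσ1 : σ = 1 := by
      ext y
      change σ y = y
      by_contra hy
      have hy' : σ (σ y) ≠ σ y := fun h => hy (σ.injective h)
      have f1 : σ (t n (σ y)) = t n (σ y) := by simpa using hfix _ hy' 1 one_ne_zero
      have f1' : σ (t n y) = t n y := by simpa using hfix _ hy 1 one_ne_zero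
      have f2 : σ (t n (t n (σ y))) = t n (t n (σ y)) := by
        simpa [pow_two] using hfix _ hy' 2 two_ne_zero
      have inv_of : ∀ {z}, σ z = z → σ⁻¹ z = z := fun {z} h => by
        conv_lhs => rw [← h]
        exact σ.symm_apply_apply z
      -- At `σ y` the two sides of the commutation relation reduce to `t n (t n y)` and `t n (t n (σ
      -- y))`, so `y = σ y`.
      have e : t n (σ (t n (σ⁻¹ (σ y)))) = σ (t n (σ⁻¹ (t n (σ y)))) :=
        congrArg (· (σ y)) hcomm.eq
      rw [inv_of f1, f2, show σ⁻¹ (σ y) = y from σ.symm_apply_apply y, f1'] at e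
      exact hy ((t n).injective ((t n).injective e)).symm
    rw [hσ1]
    exact Commute.one_left g
  · push Not at hcase
    refine Homeomorph.commute_of_disjoint_support fun x => ?_
    by_cases hx : σ x = x
    · exact Or.inl hx
    · refine Or.inr (ht.supportedOn (n + 1) g hg x ?_)
      have := hcase _ (hmoved x hx)
      rwa [hss] at this

theorem not_hasConjugatesInCommutingZConjugate (ht : IsDisplacingSequence t) :
    ¬ HasConjugatesInCommutingZConjugate (limitGroup t) := by
  classical
  rintro ⟨Λ, τ, hΛ, hS⟩
  obtain ⟨n, hn⟩ := (mem_limitGroup t τ).1 τ.2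
  let h : limitGroup t := ⟨dyadicBump, (mem_limitGroup t _).2 ⟨0, dyadicBump_mem_thompsonF⟩⟩
  let T : ℕ → limitGroup t := fun n => ⟨t n, mem_limitGroup_apply t n⟩
  -- The element `T n` makes `commute_conj` applicable; `h` and `T 0` are a noncommuting pair in
  -- stage 1.
  obtain ⟨s, hs⟩ := hS {h, T 0, T n}
  have key : ∀ a ∈ ({h, T 0, T n} : Finset (limitGroup t)),
      ∀ b ∈ ({h, T 0, T n} : Finset (limitGroup t)),
      Commute a ((s * τ * s⁻¹) * b * (s * τ * s⁻¹)⁻¹) := by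
    intro a ha b hb
    have h1 := hΛ 1 le_rfl _ (hs a ha) _ (hs b hb)
    have h2 := h1.map (MulAut.conj s)
    simp only [MulAut.conj_apply, pow_one] at h2
    rwa [show s * (s⁻¹ * a * s) * s⁻¹ = a by group,
      show s * (τ * (s⁻¹ * b * s) * τ⁻¹) * s⁻¹ = (s * τ * s⁻¹) * b * (s * τ * s⁻¹)⁻¹ by group] at h2
  have hc := ht.commute_conj hn s.2
    ((key (T n) (by simp) (T n) (by simp)).map (limitGroup t).subtype)
    (stageGroup_mono t (Nat.succ_le_succ n.zero_le)
      (Subgroup.subset_closure (mem_insert (t 0) _)))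
  have h1 := (key h (by simp) (T 0) (by simp)).map (limitGroup t).subtype
  refine ht.not_commute_dyadicBump ?_
  change Commute dyadicBump
    (((s : ℝ ≃ₜ ℝ) * τ * (s : ℝ ≃ₜ ℝ)⁻¹) * t 0 * ((s : ℝ ≃ₜ ℝ) * τ * (s : ℝ ≃ₜ ℝ)⁻¹)⁻¹) at h1
  rwa [hc.eq, mul_inv_cancel_right] at h1

end IsDisplacingSequence

/-! ### Binate and dissipated groups consist of commutators -/

/-- For the cyclic group generated by `h`, the binate relation says that `h` is the commutator of
`t` and `f h`. -/
theorem IsBinate.exists_eq_commutatorElement {Γ : Type*} [Group Γ] (hΓ : IsBinate Γ) (h : Γ) :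
    ∃ a b : Γ, h = a * b * a⁻¹ * b⁻¹ := by
  obtain ⟨f, -, t, ht⟩ := hΓ (Subgroup.zpowers h) 
    ⟨{h}, by simp [Subgroup.zpowers_eq_closure]⟩
  refine ⟨t, f ⟨h, Subgroup.mem_zpowers h⟩, ?_⟩
  rw [ht, mul_inv_cancel_right]

/-- Here `f` is the infinite product of the conjugates of `g` by `t ^ p` over `p ≥ 1`. Conjugating
by `t⁻¹` adds the factor `p = 0`, which gives `t⁻¹ f t = g f`. -/
theorem IsDissipator.exists_eq_commutatorElement {X : Type*} {Γ : Subgroup (Equiv.Perm X)}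
    {B : Set X} {t : Equiv.Perm X} (ht : IsDissipator Γ B t) {g : Equiv.Perm X} (hg : g ∈ Γ)
    (hgB : movedSet g ⊆ B) : ∃ f ∈ Γ, g = t⁻¹ * f * t⁻¹⁻¹ * f⁻¹ := by
  obtain ⟨-, hdisj, hex⟩ := ht
  obtain ⟨f, hf, hfin, hfout⟩ := hex g hg hgB
  have hdisj' : ∀ p : ℕ, 1 ≤ p → ∀ x ∈ B, (t ^ p) x ∉ B := fun p hp x hx h =>
    Set.disjoint_left.1 (Set.disjoint_iff_inter_eq_empty.2 (hdisj p hp))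
      (mem_image_of_mem _ hx) h
  have hgfix : ∀ x, x ∉ B → g x = x := fun x hx => by
    by_contra h
    exact hx (hgB h)
  have hgmem : ∀ x ∈ B, g x ∈ B := fun x hx => by
    by_contra h
    exact h (by rwa [g.injective (hgfix _ h)])
  have hft : ∀ p : ℕ, 1 ≤ p → ∀ y ∈ B, f ((t ^ p) y) = (t ^ p) (g y) := fun p hp y hy => by
    rw [hfin p hp _ (mem_image_of_mem _ hy)]
    simp
  have key : f * t = t * (g * f) := by
    ext x
    change f (t x) = t (g (f x))
    by_cases hxB : x ∈ B
    · rw [hfout x fun p hp hx => ?_]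
      · simpa using hft 1 le_rfl x hxB
      · obtain ⟨y, hy, rfl⟩ := hx
        exact hdisj' p hp y hy hxB
    · by_cases hx : ∃ p : ℕ, 1 ≤ p ∧ x ∈ (t ^ p) '' B
      · obtain ⟨p, hp, y, hy, rfl⟩ := hx
        rw [hft p hp y hy, hgfix _ (hdisj' p hp _ (hgmem y hy))]
        have := hft (p + 1) (by omega) y hy
        simpa [pow_succ'] using this
      · push Not at hx
        rw [hfout x hx, hgfix x hxB]
        refine hfout _ fun p hp hpx => ?_
        obtain ⟨y, hy, hyx⟩ := hpx
        obtain ⟨q, rfl⟩ : ∃ q, p = q + 1 := ⟨p - 1, by omega⟩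
        rw [pow_succ', Equiv.Perm.mul_apply] at hyx
        have hyx := t.injective hyx
        -- Cancelling one `t` may leave the exponent `0`, where the point would be in `B` itself.
        rcases Nat.eq_zero_or_pos q with rfl | hq
        · exact hxB (by simpa using hyx ▸ hy)
        · exact hx q hq ⟨y, hy, hyx⟩
  refine ⟨f, hf, ?_⟩
  rw [inv_inv, mul_assoc t⁻¹, key]
  group

theorem IsDissipated.exists_eq_commutatorElement {Γ : Type v} [Group Γ]
    (hΓ : IsDissipated.{u, v} Γ) (h : Γ) : ∃ a b : Γ, h = a * b * a⁻¹ * b⁻¹ := by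
  obtain ⟨X, φ, 𝓑, hφ, ⟨-, -, hB⟩, hdiss⟩ := hΓ
  obtain ⟨B, hB, hhB⟩ := hB (φ h) ⟨h, rfl⟩
  obtain ⟨t, ht⟩ := hdiss B hB
  obtain ⟨_, ⟨f, rfl⟩, hf⟩ := ht.exists_eq_commutatorElement ⟨h, rfl⟩ hhB
  obtain ⟨s, rfl⟩ := ht.1
  exact ⟨s⁻¹, f, hφ (by simpa using hf)⟩

theorem mainTheorem3 :
    (∃ t : ℕ → ℝ ≃ₜ ℝ, IsDisplacingSequence t) ∧
    ∀ t : ℕ → ℝ ≃ₜ ℝ, IsDisplacingSequence t →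
      HasCommutingZConjugates (limitGroup t) ∧
      ¬ IsBinate (limitGroup t) ∧
      ¬ IsDissipated.{u, 0} (limitGroup t) ∧
      ¬ HasConjugatesInCommutingZConjugate (limitGroup t) := by
  refine ⟨exists_isDisplacingSequence, fun t ht => ?_⟩
  obtain ⟨h, hh⟩ := ht.exists_ne_commutatorElement
  refine ⟨ht.hasCommutingZConjugates, fun hb => ?_, fun hd => ?_,
    ht.not_hasConjugatesInCommutingZConjugate⟩
  · obtain ⟨a, b, hab⟩ := hb.exists_eq_commutatorElement h
    exact hh a b hab
  · obtain ⟨a, b, hab⟩ := hd.exists_eq_commutatorElement h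
    exact hh a b hab
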